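/- **Theorem (semantic security of MPHE encryption under RLWE).** Let $\kappa$ be the security parameter; all quantities below may depend on $\kappa$. Let $n$ be a power of two, $Q$ a product of at least one distinct primes, and $R_Q=\mathbb Z_Q[X]/(X^n+1)$; assume that $n$, $\log Q$ and the number of parties $N$ are polynomially bounded in $\kappa$. Let $\chi_{\rm key},\chi_{\rm enc},\chi_{\rm err}$ be probability distributions on $R_Q$. The scheme MPHE is the following. * *Setup.* A common reference polynomial $a\in R_Q$ is uniformly random. Independently, each party $i\in\{0,\dots,N-1\}$ draws $s_i\leftarrow\chi_{\rm key}$ and $e_i\leftarrow\chi_{\rm err}$; its secret key is $sk_i=s_i$ and its public key is $pk_i=(b_i,a)$ with $b_i=-(a s_i+e_i)$. The common public key is $\mathsf{cpk}=(\sum_i b_i,\,a)$. * *Encryption.* For a plaintext polynomial $m\in R_Q$ and $\mathsf{cpk}=(p_0,p_1)$: draw $u\leftarrow\chi_{\rm enc}$ and $e_0',e_1'\leftarrow\chi_{\rm err}$ and output $\mathsf{MPHE.Enc}(\mathsf{cpk},m)=(u p_0+e_0'+m,\ u p_1+e_1')$. For a coalition $S$ of parties let its view consist of $a$, $\mathsf{cpk}$,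 all $pk_i$, and $(s_i,e_i)$ for $i\in S$. An adversary is a (non-uniform) family of probabilistic Boolean circuits whose number of gates and random bits (and of bits of state passed between stages) is bounded by a polynomial in $\kappa$; ring elements are given to it by the binary expansions of their $n$ coefficients. Decision RLWE with $m$ samples, secret distribution $\chi$ and error distribution $\chi_{\rm err}$ is *hard* if every such family distinguishes $(a_i,a_i s+e_i)_{i\le m}$, with $s\leftarrow\chi$, $a_i$ uniform in $R_Q$ and $e_i\leftarrow\chi_{\rm err}$ independent, from $m$ independent uniform pairs in $R_Q^2$ with at most negligible advantage in $\kappa$. Assume that decision RLWE is hard for $\chi_{\rm key}$ with one sample and for $\chi_{\rm enc}$ with two samples. Let $S=S_\kappa$ be any coalition of at most $N-1$ parties. Then: 1. For any two messages $m_1,m_2\in R_Q$ (depending on $\kappa$ only): if $\beta\in\{1,2\}$ is uniformly random, every adversary which is given the view of $S$ and the ciphertext $\mathsf{MPHE.Enc}(\mathsf{cpk},m_\beta)$ guesses $\beta$ with a probability that differs from $1/2$ by at most a negligible function of $\kappa$. 2. The same holds if the adversary chooses $m_1,m_2$ itself after having seen the view of $S$ (IND-CPA security). -/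

import Mathlib

open scoped ENNReal

noncomputable section

namespace MPHE

/-! ### Polynomial growth, products of distributions -/

/-- `f` is bounded by a polynomial in the security parameter. -/
def PolyBounded (f : ℕ → ℕ) : Prop :=
  ∃ p : Polynomial ℕ, ∀ κ, f κ ≤ p.eval κ

/-- A function of the security parameter is negligible if it decays faster than every inverse
polynomial. -/
def Negligible (f : ℕ → ℝ) : Prop :=
  Asymptotics.SuperpolynomialDecay Filter.atTop (fun κ : ℕ => (κ : ℝ)) f

/-- Independent identically distributed samples, indexed by `ι`. -/
def iid {α : Type} [Fintype α] (ι : Type) [Fintype ι] (p : PMF α) : PMF (ι → α) := by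
  classical
  exact PMF.ofFintype (fun f => ∏ i, p (f i)) (by
    have h : ∑ a, p a = 1 := by rw [← tsum_fintype (L := .unconditional _)]; exact p.tsum_coe
    have h2 := Finset.prod_univ_sum (fun _ : ι => (Finset.univ : Finset α)) (fun _ a => p a)
    simp only [h, Finset.prod_const_one, Fintype.piFinset_univ] at h2
    exact h2.symm)

/-! ### The ring `R_Q = ℤ_Q[X] / (X ^ n + 1)` -/

/-- Ring parameters: the dimension is `2 ^ logDim`, the modulus is a product of (at least one)
distinct primes. -/
structure RingParams where
  logDim : ℕ
  primes : Finset ℕ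
  prime_of_mem : ∀ q ∈ primes, q.Prime
  nonempty : primes.Nonempty

namespace RingParams

variable (P : RingParams)

/-- The dimension, a power of two. -/
def dim : ℕ := 2 ^ P.logDim

/-- The ciphertext modulus. -/
def modulus : ℕ := ∏ q ∈ P.primes, q

/-- The bit length of the modulus. -/
def bitLen : ℕ := Nat.size P.modulus

instance modulus_neZero : NeZero P.modulus :=
  ⟨Finset.prod_ne_zero_iff.2 fun q hq => (P.prime_of_mem q hq).ne_zero⟩

/-- The polynomial `X ^ n + 1` over `ℤ_Q`. -/
def poly : Polynomial (ZMod P.modulus) := Polynomial.X ^ P.dim + Polynomial.C 1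

theorem poly_monic : P.poly.Monic :=
  Polynomial.monic_X_pow_add_C _ (pow_ne_zero _ two_ne_zero)

/-- The ring `R_Q = ℤ_Q[X] / (X ^ n + 1)`. -/
abbrev Rq : Type := AdjoinRoot P.poly

instance finite_Rq : Finite P.Rq :=
  haveI : Module.Finite (ZMod P.modulus) P.Rq := .of_basis (AdjoinRoot.powerBasis' P.poly_monic).basis
  Module.finite_of_finite (ZMod P.modulus)

instance fintype_Rq : Fintype P.Rq := Fintype.ofFinite _

/-- Bit positions of a ring element: `n` coefficients of `bitLen` bits each. -/
abbrev Pos : Type := Fin P.dim × Fin P.bitLen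

/-- Coefficient `j` of (the reduced representative of) a ring element. -/
def coeff (x : P.Rq) (j : ℕ) : ZMod P.modulus :=
  (AdjoinRoot.modByMonicHom P.poly_monic x).coeff j

/-- Binary encoding: every coefficient is written in binary as a number in `{0, …, Q - 1}`. -/
def encode (x : P.Rq) : P.Pos → Bool :=
  fun jk => (P.coeff x jk.1).val.testBit jk.2

/-- Decoding of a string of bits into a ring element (coefficients are reduced modulo `Q`). -/
def decode (b : P.Pos → Bool) : P.Rq :=
  AdjoinRoot.mk P.poly
    (∑ j, Polynomial.C (∑ k, if b (j, k) then (2 ^ (k : ℕ) : ZMod P.modulus) else 0) *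
      Polynomial.X ^ (j : ℕ))

/-- Binary encoding of a family of ring elements. -/
def encodeFam {I : Type} (x : I → P.Rq) : I × P.Pos → Bool :=
  fun ijk => P.encode (x ijk.1) ijk.2

end RingParams

/-! ### Boolean circuits -/

/-- A Boolean circuit with `s` gates on input wires `ι`, built gate by gate. A gate is a constant
or an arbitrary binary connective applied to two earlier wires. -/
inductive Gates (ι : Type) : ℕ → Type
  | nil : Gates ι 0
  | const {s : ℕ} (C : Gates ι s) (b : Bool) : Gates ι (s + 1)
  | op {s : ℕ} (C : Gates ι s) (g : Bool → Bool → Bool) (x y : ι ⊕ Fin s) : Gates ι (s + 1)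

/-- The values of all wires of a circuit on a given input. -/
def Gates.eval {ι : Type} (inp : ι → Bool) : {s : ℕ} → Gates ι s → ι ⊕ Fin s → Bool
  | _, .nil => Sum.elim inp Fin.elim0
  | _, .const C b => Sum.elim inp (Fin.snoc (fun i => C.eval inp (.inr i)) b)
  | _, .op C g x y =>
      Sum.elim inp (Fin.snoc (fun i => C.eval inp (.inr i)) (g (C.eval inp x) (C.eval inp y)))

/-- A probabilistic Boolean circuit with input bits `ι` and output bits `o`: in addition to its
input it reads `coins` independent uniformly random bits. -/
structure Circuit (ι o : Type) where
  coins : ℕ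
  size : ℕ
  gates : Gates (ι ⊕ Fin coins) size
  out : o → (ι ⊕ Fin coins) ⊕ Fin size

namespace Circuit

variable {ι o : Type}

/-- The cost of a circuit: number of gates plus number of random bits. -/
def cost (C : Circuit ι o) : ℕ := C.size + C.coins

/-- The output for given coins. -/
def eval (C : Circuit ι o) (inp : ι → Bool) (r : Fin C.coins → Bool) : o → Bool :=
  fun j => C.gates.eval (Sum.elim inp r) (C.out j)

/-- The output distribution. -/
def run (C : Circuit ι o) (inp : ι → Bool) : PMF (o → Bool) :=
  (PMF.uniformOfFintype (Fin C.coins → Bool)).map (C.eval inp)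

/-- The output distribution of a circuit with one output bit. -/
def runBit (C : Circuit ι Unit) (inp : ι → Bool) : PMF Bool :=
  (C.run inp).map fun f => f ()

end Circuit

/-! ### Decision ring learning with errors -/

section RLWE

variable (P : RingParams)

/-- Index set of the ring elements in `m` pairs `(a_i, b_i)`. -/
abbrev SampleIdx (m : ℕ) : Type := Fin m ⊕ Fin m

/-- `m` RLWE samples `(a_i, a_i * s + e_i)` under one secret `s`. -/
def rlweSamples (secret err : PMF P.Rq) (m : ℕ) : PMF (SampleIdx m → P.Rq) := do
  let s ← secret
  let a ← iid (Fin m) (PMF.uniformOfFintype P.Rq)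
  let e ← iid (Fin m) err
  return Sum.elim a fun i => a i * s + e i

/-- `m` uniformly random pairs. -/
def uniformSamples (m : ℕ) : PMF (SampleIdx m → P.Rq) :=
  iid (SampleIdx m) (PMF.uniformOfFintype P.Rq)

/-- Probability that a distinguisher outputs `1` on a tuple of ring elements drawn from `d`. -/
def acceptProb {I : Type} (D : Circuit (I × P.Pos) Unit) (d : PMF (I → P.Rq)) : ℝ :=
  ((do let x ← d; D.runBit (P.encodeFam x) : PMF Bool) true).toReal

end RLWE

/-- Hardness of decision RLWE with `m` samples: every family of polynomial-size probabilistic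
circuits has negligible advantage in distinguishing `m` RLWE samples from uniform. -/
def RLWEHard (P : ℕ → RingParams) (secret err : ∀ κ, PMF (P κ).Rq) (m : ℕ) : Prop :=
  ∀ D : ∀ κ, Circuit (SampleIdx m × (P κ).Pos) Unit,
    PolyBounded (fun κ => (D κ).cost) →
    Negligible fun κ =>
      |acceptProb (P κ) (D κ) (rlweSamples (P κ) (secret κ) (err κ) m) -
        acceptProb (P κ) (D κ) (uniformSamples (P κ) m)|

/-! ### The multiparty encryption scheme -/

/-- Parameters of the scheme: ring, number of parties, and the distributions (modulo `Q`) of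
secret keys, of the ephemeral secret used in encryption, and of errors. -/
structure Params extends RingParams where
  parties : ℕ
  keyDist : PMF toRingParams.Rq
  encDist : PMF toRingParams.Rq
  errDist : PMF toRingParams.Rq

namespace Params

variable (P : Params)

/-- One party's secret key and key-generation error `(s_i, e_i)`. -/
def keySecrets : PMF (P.Rq × P.Rq) := do
  let s ← P.keyDist
  let e ← P.errDist
  return (s, e)

/-- The public key `(-(a * s + e), a)` determined by the common reference polynomial `a` and a
party's secrets `(s, e)`. -/
def publicKey (a : P.Rq) (se : P.Rq × P.Rq) : P.Rq × P.Rq := (-(a * se.1 + se.2), a)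

/-- The collective public key: the first components are summed, the second component is the
common reference polynomial. -/
def collectiveKey (a : P.Rq) (pk : Fin P.parties → P.Rq × P.Rq) : P.Rq × P.Rq :=
  (∑ i, (pk i).1, a)

/-- Encryption of an encoded message under a public key. -/
def enc (cpk : P.Rq × P.Rq) (m : P.Rq) : PMF (P.Rq × P.Rq) := do
  let u ← P.encDist
  let e₀ ← P.errDist
  let e₁ ← P.errDist
  return (u * cpk.1 + e₀ + m, u * cpk.2 + e₁)

/-- The setup phase: the common reference polynomial is uniform, and every party draws its
secrets independently. -/
def setup : PMF (P.Rq × (Fin P.parties → P.Rq × P.Rq)) := do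
  let a ← PMF.uniformOfFintype P.Rq
  let se ← iid (Fin P.parties) P.keySecrets
  return (a, se)

/-- The public keys resulting from the setup phase. -/
def publicKeys (k : P.Rq × (Fin P.parties → P.Rq × P.Rq)) : Fin P.parties → P.Rq × P.Rq :=
  fun i => P.publicKey k.1 (k.2 i)

/-- The collective public key `cpk` resulting from the setup phase. -/
def cpk (k : P.Rq × (Fin P.parties → P.Rq × P.Rq)) : P.Rq × P.Rq :=
  P.collectiveKey k.1 (P.publicKeys k)

end Params

/-- The ring elements seen by a coalition `S` after the setup phase. -/
inductive ViewIdx {N : ℕ} (S : Finset (Fin N)) : Type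
  | crs
  | cpk
  | pk (i : Fin N)
  | sk (i : S)
  | err (i : S)

namespace Params

variable (P : Params)

/-- The view of a coalition `S` after the setup phase: the common reference polynomial, the
collective key, all public keys, and the secret keys and key-generation errors of the members of
`S`. (The second components of all public keys are the common reference polynomial.) -/
def view (S : Finset (Fin P.parties)) (k : P.Rq × (Fin P.parties → P.Rq × P.Rq)) :
    ViewIdx S → P.Rq
  | .crs => k.1
  | .cpk => (P.cpk k).1
  | .pk i => (P.publicKeys k i).1
  | .sk i => (k.2 i).1
  | .err i => (k.2 i).2

/-- The view of a coalition followed by a ciphertext. -/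
def viewWith (S : Finset (Fin P.parties)) (k : P.Rq × (Fin P.parties → P.Rq × P.Rq))
    (ct : P.Rq × P.Rq) : ViewIdx S ⊕ Fin 2 → P.Rq :=
  Sum.elim (P.view S k) ![ct.1, ct.2]

/-- The distinguishing game for two fixed messages: a uniform bit selects the message which is
encrypted under `cpk`; the adversary, given the view of `S` and the ciphertext, guesses the bit.
The game returns whether the guess is correct. -/
def fixedGame (S : Finset (Fin P.parties)) (m₁ m₂ : P.Rq)
    (A : Circuit ((ViewIdx S ⊕ Fin 2) × P.Pos) Unit) : PMF Bool := do
  let b ← PMF.uniformOfFintype Bool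
  let k ← P.setup
  let ct ← P.enc (P.cpk k) (if b then m₂ else m₁)
  let b' ← A.runBit (P.encodeFam (P.viewWith S k ct))
  return b' == b

/-- A chosen-plaintext adversary corrupting `S`: from the view of `S` the first circuit outputs
two messages and a state of `stateLen` bits; the second circuit gets the state, the view and the
challenge ciphertext, and outputs a guess. -/
structure Adversary (S : Finset (Fin P.parties)) where
  stateLen : ℕ
  choose : Circuit (ViewIdx S × P.Pos) ((Bool × P.Pos) ⊕ Fin stateLen)
  guess : Circuit (((ViewIdx S ⊕ Fin 2) × P.Pos) ⊕ Fin stateLen) Unit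

/-- The total cost of an adversary. -/
def Adversary.cost {P : Params} {S : Finset (Fin P.parties)} (A : P.Adversary S) : ℕ :=
  A.stateLen + A.choose.cost + A.guess.cost

/-- The chosen-plaintext game: as the distinguishing game, except that the adversary chooses the
two messages after having seen the view of `S`. -/
def cpaGame (S : Finset (Fin P.parties)) (A : P.Adversary S) : PMF Bool := do
  let b ← PMF.uniformOfFintype Bool
  let k ← P.setup
  let w ← A.choose.run (P.encodeFam (P.view S k))
  let m : P.Rq := P.decode fun p => w (.inl (b, p))
  let ct ← P.enc (P.cpk k) m
  let b' ← A.guess.runBit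
    (Sum.elim (P.encodeFam (P.viewWith S k ct)) fun i => w (.inr i))
  return b' == b

end Params

/-- The advantage over guessing in a game that returns whether the adversary won. -/
def advantage (game : PMF Bool) : ℝ := |(game true).toReal - 1 / 2|

end MPHE

end

/-!
An adversary may be assumed to be deterministic, its coins being fixed to the best possible value.
Let `h` be an honest party. Given one sample `(a, c)`, use `a` as the common reference polynomial
and `-c` as the key of `h`, and draw all other secrets. An RLWE sample yields the real game; a
uniform sample makes the key of `h`, and hence the collective key `(p, a)`, uniform. Then `(p, a)`
and an encryption of zero are two RLWE samples under the ephemeral secret of the encryption. When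
these are replaced by uniform pairs, the ciphertext is a one-time pad, so that the challenge bit
is independent of everything the adversary sees.

Once the secrets drawn by a simulator are hard-wired, every ring element it produces is an affine
function of its samples. As `R_Q` is a free `ℤ_Q`-module, each bit of an affine function is
computed by polynomially many gates, namely by conditional additions of constants modulo `Q`; hence
the distinguishers are small. They do not have to materialize the view, whose length depends on the
number of parties: every gate of the adversary recomputes the at most two bits it reads.
-/

noncomputable section

namespace MPHE

/-! ### Straight-line programs -/

/-- The functions in `G` can be computed from those in `F` by a straight-line program of `k`
gates. Circuits are manipulated through the sets of functions they compute, so that no wires have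
to be renumbered when programs are composed. -/
inductive Derives {X : Type} : Set (X → Bool) → ℕ → Set (X → Bool) → Prop
  | done {F G : Set (X → Bool)} {k : ℕ} (h : G ⊆ F) : Derives F k G
  | const {F G : Set (X → Bool)} {k : ℕ} (b : Bool)
      (h : Derives (insert (fun _ => b) F) k G) : Derives F (k + 1) G
  | op {F G : Set (X → Bool)} {k : ℕ} (o : Bool → Bool → Bool) {f g : X → Bool}
      (hf : f ∈ F) (hg : g ∈ F)
      (h : Derives (insert (fun x => o (f x) (g x)) F) k G) : Derives F (k + 1) G

namespace Derives

variable {X Y : Type} {F F' G G' : Set (X → Bool)} {k l : ℕ}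

theorem weaken (h : Derives F k G) (hF : F ⊆ F') (hG : G' ⊆ G) (hkl : k ≤ l) :
    Derives F' l G' := by
  induction h generalizing F' G' l with
  | done h => exact .done (hG.trans (h.trans hF))
  | const b _ ih =>
    obtain ⟨l, rfl⟩ := Nat.exists_eq_add_of_le' (Nat.one_le_of_lt hkl)
    exact .const b (ih (Set.insert_subset_insert hF) hG (by omega))
  | op o hf hg _ ih =>
    obtain ⟨l, rfl⟩ := Nat.exists_eq_add_of_le' (Nat.one_le_of_lt hkl)
    exact .op o (hF hf) (hF hg) (ih (Set.insert_subset_insert hF) hG (by omega))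

theorem of_subset (h : Derives F k G) (hF : F ⊆ F') : Derives F' k G :=
  h.weaken hF subset_rfl le_rfl

theorem subset (h : Derives F k G) (hG : G' ⊆ G) : Derives F k G' :=
  h.weaken subset_rfl hG le_rfl

theorem mono (h : Derives F k G) (hkl : k ≤ l) : Derives F l G :=
  h.weaken subset_rfl subset_rfl hkl

theorem keep (h : Derives F k G) : Derives F k (F ∪ G) := by
  induction h with
  | done h => exact .done (Set.union_subset subset_rfl h)
  | const b _ ih =>
    exact .const b (ih.subset (Set.union_subset_union_left _ (Set.subset_insert _ _)))
  | op o hf hg _ ih =>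
    exact .op o hf hg (ih.subset (Set.union_subset_union_left _ (Set.subset_insert _ _)))

theorem trans (h : Derives F k G) (h' : Derives (F ∪ G) l G') : Derives F (k + l) G' := by
  induction h generalizing G' l with
  | done h => exact h'.weaken (Set.union_subset subset_rfl h) subset_rfl (Nat.le_add_left _ _)
  | const b _ ih =>
    rw [Nat.add_right_comm]
    exact .const b (ih (h'.of_subset (Set.union_subset_union_left _ (Set.subset_insert _ _))))
  | op o hf hg _ ih =>
    rw [Nat.add_right_comm]
    exact .op o hf hg (ih (h'.of_subset (Set.union_subset_union_left _ (Set.subset_insert _ _))))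

theorem union (h : Derives F k G) (h' : Derives F l G') : Derives F (k + l) (G ∪ G') :=
  h.trans ((h'.of_subset Set.subset_union_left).keep.subset
    (Set.union_subset_union_left _ Set.subset_union_right))

theorem biUnion {J : Type} (s : Finset J) {G : J → Set (X → Bool)}
    (h : ∀ j ∈ s, Derives F k (G j)) : Derives F (s.card * k) (⋃ j ∈ s, G j) := by
  classical
  induction s using Finset.induction_on with
  | empty => exact .done (by simp only [Finset.notMem_empty, Set.iUnion_of_empty,
      Set.iUnion_empty, Set.empty_subset])
  | insert a s ha ih =>
    rw [Finset.card_insert_of_notMem ha, Finset.set_biUnion_insert, add_mul, one_mul, add_comm]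
    exact (h a (Finset.mem_insert_self _ _)).union
      (ih fun j hj => h j (Finset.mem_insert_of_mem hj))

theorem range {J : Type} [Fintype J] {g : J → X → Bool} (h : ∀ j, Derives F k {g j}) :
    Derives F (Fintype.card J * k) (Set.range g) :=
  (biUnion Finset.univ fun j _ => h j).subset (by simp)

theorem gate (o : Bool → Bool → Bool) {f g : X → Bool} (hf : f ∈ F) (hg : g ∈ F) :
    Derives F 1 {fun x => o (f x) (g x)} :=
  .op o hf hg (.done (Set.singleton_subset_iff.2 (Set.mem_insert _ _)))

theorem consts : Derives F 2 (Set.range fun (b : Bool) (_ : X) => b) :=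
  .const true (.const false (.done (by
    rintro _ ⟨_ | _, rfl⟩
    · exact .inl rfl
    · exact .inr (.inl rfl))))

-- A program reads at most two of the functions in `F` per gate, so its cost after the
-- substitution does not depend on the number of inputs.
theorem comp (h : Derives F k G) (φ : Y → X) {F₀ : Set (Y → Bool)} {A : ℕ}
    (hF : ∀ f ∈ F, Derives F₀ A {f ∘ φ}) {J : Type} [Fintype J] {g : J → X → Bool}
    (hg : ∀ j, g j ∈ G) :
    Derives F₀ (k * (2 * A + 1) + Fintype.card J * A) (Set.range fun j => g j ∘ φ) := by
  induction h generalizing F₀ with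
  | done h => exact (range fun j => hF _ (h (hg j))).mono (Nat.le_add_left _ _)
  | @const F G k b _ ih =>
    have hb : ∀ f ∈ insert (fun _ => b) F, Derives (insert (fun _ => b) F₀) A {f ∘ φ} := by
      rintro f (rfl | hf)
      · exact .done (Set.singleton_subset_iff.2 (.inl rfl))
      · exact (hF f hf).of_subset (Set.subset_insert _ _)
    exact (Derives.const b (ih hb hg)).mono (by ring_nf; omega)
  | @op F G k o f₁ f₂ hf₁ hf₂ _ ih =>
    refine (((hF f₁ hf₁).union (hF f₂ hf₂)).trans
      (.op o (.inr (.inl rfl)) (.inr (.inr rfl)) (ih ?_ hg))).mono (by ring_nf; omega)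
    rintro f (rfl | hf)
    · exact .done (Set.singleton_subset_iff.2 (.inl rfl))
    · exact (hF f hf).of_subset (Set.subset_union_left.trans (Set.subset_insert _ _))

end Derives

/-! ### Circuits as straight-line programs -/

section Circuits

variable {ι o X : Type}

/-- The bits of an input string `φ x` depending on a parameter `x`, as functions of `x`. -/
def inputs (φ : X → ι → Bool) : Set (X → Bool) :=
  Set.range fun i x => φ x i

/-- The functions of the parameter `x` which the wires of a circuit carry on the input `φ x`. -/
def Gates.funs (φ : X → ι → Bool) {s : ℕ} (C : Gates ι s) : Set (X → Bool) :=
  Set.range fun w x => C.eval (φ x) w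

theorem Gates.eval_inl (inp : ι → Bool) {s : ℕ} (C : Gates ι s) (i : ι) :
    C.eval inp (.inl i) = inp i := by
  cases C <;> rfl

theorem Gates.funs_eq_union (φ : X → ι → Bool) {s : ℕ} (C : Gates ι s) :
    C.funs φ = inputs φ ∪ Set.range fun i x => C.eval (φ x) (.inr i) := by
  rw [inputs, ← Set.Sum.elim_range]
  refine congrArg Set.range (funext ?_)
  rintro (i | i)
  · exact funext fun x => C.eval_inl (φ x) i
  · rfl

theorem Gates.funs_const (φ : X → ι → Bool) {s : ℕ} (C : Gates ι s) (b : Bool) :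
    (C.const b).funs φ = insert (fun _ => b) (C.funs φ) := by
  rw [funs_eq_union, funs_eq_union, ← Set.union_insert]
  congr 1
  rw [← Fin.range_snoc]
  refine congrArg _ (funext fun i => ?_)
  cases i using Fin.lastCases <;> simp [Gates.eval]

theorem Gates.funs_op (φ : X → ι → Bool) {s : ℕ} (C : Gates ι s)
    (g : Bool → Bool → Bool) (u v : ι ⊕ Fin s) :
    (C.op g u v).funs φ =
      insert (fun x => g (C.eval (φ x) u) (C.eval (φ x) v)) (C.funs φ) := by
  rw [funs_eq_union, funs_eq_union, ← Set.union_insert]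
  congr 1
  rw [← Fin.range_snoc]
  refine congrArg _ (funext fun i => ?_)
  cases i using Fin.lastCases <;> simp [Gates.eval]

theorem Gates.derives (φ : X → ι → Bool) {s : ℕ} (C : Gates ι s) :
    Derives (inputs φ) s (C.funs φ) := by
  induction C with
  | nil => exact .done (by simp [funs_eq_union])
  | const C b ih =>
    rw [Gates.funs_const]
    exact ih.trans (.const b (.done (Set.insert_subset_insert Set.subset_union_right)))
  | op C g u v ih =>
    rw [Gates.funs_op]
    exact ih.trans (.op g (.inr ⟨u, rfl⟩) (.inr ⟨v, rfl⟩)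
      (.done (Set.insert_subset_insert Set.subset_union_right)))

theorem Derives.exists_gates (φ : X → ι → Bool) {F G : Set (X → Bool)} {k : ℕ}
    (h : Derives F k G) {s : ℕ} (C : Gates ι s) (hC : F ⊆ C.funs φ) :
    ∃ t ≤ s + k, ∃ C' : Gates ι t, G ⊆ C'.funs φ := by
  induction h generalizing s with
  | done h => exact ⟨s, Nat.le_add_right _ _, C, h.trans hC⟩
  | const b _ ih =>
    obtain ⟨t, ht, C', h'⟩ := ih (C.const b)
      (by rw [Gates.funs_const]; exact Set.insert_subset_insert hC)
    exact ⟨t, by omega, C', h'⟩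
  | op o hf hg _ ih =>
    obtain ⟨u, rfl⟩ := hC hf
    obtain ⟨v, rfl⟩ := hC hg
    obtain ⟨t, ht, C', h'⟩ := ih (C.op o u v)
      (by rw [Gates.funs_op]; exact Set.insert_subset_insert hC)
    exact ⟨t, by omega, C', h'⟩

theorem Derives.exists_circuit (φ : X → ι → Bool) {f : X → Bool} {k : ℕ}
    (h : Derives (inputs φ) k {f}) :
    ∃ D : Circuit ι Unit, D.cost ≤ k ∧ ∀ x, D.runBit (φ x) = PMF.pure (f x) := by
  obtain ⟨t, ht, C, hC⟩ := h.exists_gates (fun x => Sum.elim (φ x) Fin.elim0)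
    (.nil : Gates (ι ⊕ Fin 0) 0) (by
      rw [Gates.funs_eq_union]
      rintro _ ⟨i, rfl⟩
      exact .inl ⟨.inl i, rfl⟩)
  obtain ⟨w, hw⟩ := hC (Set.mem_singleton f)
  let D : Circuit ι Unit := ⟨0, t, C, fun _ => w⟩
  have hD (x : X) : (fun y : Unit → Bool => y ()) ∘ D.eval (φ x) = Function.const _ (f x) := by
    funext r
    rw [← hw, Subsingleton.elim r Fin.elim0]
    rfl
  refine ⟨D, by simpa only [Circuit.cost, D, zero_add, add_zero] using ht, fun x => ?_⟩
  rw [Circuit.runBit, Circuit.run, PMF.map_comp, hD, PMF.map_const]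

theorem Circuit.derives (C : Circuit ι o) (r : Fin C.coins → Bool) (φ : X → ι → Bool) :
    Derives (inputs φ) (2 + C.cost) (Set.range fun j x => C.eval (φ x) r j) := by
  have hgates := C.gates.derives fun x => Sum.elim (φ x) r
  refine (Derives.consts.trans ((hgates.of_subset ?_).subset ?_)).mono
    (Nat.add_le_add_left (Nat.le_add_right _ _) 2)
  · rintro _ ⟨i | i, rfl⟩
    · exact .inl ⟨i, rfl⟩
    · exact .inr ⟨r i, rfl⟩
  · rintro _ ⟨j, rfl⟩
    exact ⟨C.out j, rfl⟩

end Circuits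

/-! ### Binary arithmetic modulo `Q` -/

section Arithmetic

variable {X : Type} {F : Set (X → Bool)} {L : ℕ}

theorem derives_atLeastTwo {f g h : X → Bool} (hf : f ∈ F) (hg : g ∈ F) (hh : h ∈ F) :
    Derives F 4 {fun x => Bool.atLeastTwo (f x) (g x) (h x)} := by
  refine .op (· && ·) hg hh (.op (· || ·) (.inr hg) (.inr hh) (.op (· && ·) (.inr (.inr hf))
    (.inl rfl) (.op (· || ·) (.inl rfl) (.inr (.inr (.inl rfl))) (.done ?_))))
  refine Set.singleton_subset_iff.2 (.inl (funext fun x => ?_))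
  cases f x <;> cases g x <;> cases h x <;> rfl

theorem derives_xor_xor {f g h : X → Bool} (hf : f ∈ F) (hg : g ∈ F) (hh : h ∈ F) :
    Derives F 2 {fun x => f x ^^ (g x ^^ h x)} :=
  .op (· ^^ ·) hg hh (.gate (· ^^ ·) (.inr hf) (.inl rfl))

/-- The bits of a function with values in the bit vectors of length `L`. -/
def bits (ξ : X → BitVec L) : Set (X → Bool) :=
  Set.range fun (i : Fin L) x => (ξ x).getLsbD i

theorem getLsbD_mem_of_bits_subset {ξ : X → BitVec L} (hξ : bits ξ ⊆ F) {i : ℕ} (hi : i < L) :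
    (fun x => (ξ x).getLsbD i) ∈ F :=
  hξ ⟨⟨i, hi⟩, rfl⟩

theorem derives_carry {ξ η : X → BitVec L} (c : Bool) (hc : (fun _ => c) ∈ F)
    (hξ : bits ξ ⊆ F) (hη : bits η ⊆ F) {i : ℕ} (hi : i ≤ L) :
    Derives F (4 * i) ((fun j x => BitVec.carry j (ξ x) (η x) c) '' Set.Iic i) := by
  induction i with
  | zero =>
    refine .done ?_
    rintro _ ⟨j, hj, rfl⟩
    obtain rfl : j = 0 := Nat.le_zero.1 hj
    simpa only [BitVec.carry_zero] using hc
  | succ i ih =>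
    have hnext := derives_atLeastTwo
      (F := F ∪ (fun j x => BitVec.carry j (ξ x) (η x) c) '' Set.Iic i)
      (.inl (getLsbD_mem_of_bits_subset hξ (Nat.lt_of_succ_le hi)))
      (.inl (getLsbD_mem_of_bits_subset hη (Nat.lt_of_succ_le hi)))
      (.inr ⟨i, Set.self_mem_Iic, rfl⟩)
    refine (ih (Nat.le_of_succ_le hi)).trans (hnext.keep.subset ?_)
    rintro _ ⟨j, hj, rfl⟩
    rcases Nat.of_le_succ hj with hj | rfl
    · exact .inl (.inr ⟨j, hj, rfl⟩)
    · exact .inr (funext fun x => BitVec.carry_succ i (ξ x) (η x) c)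

theorem derives_add {ξ η : X → BitVec L} (hc : (fun _ => false) ∈ F)
    (hξ : bits ξ ⊆ F) (hη : bits η ⊆ F) :
    Derives F (6 * L) (bits fun x => ξ x + η x) := by
  refine ((derives_carry false hc hξ hη le_rfl).trans
    (Derives.range (k := 2) fun i : Fin L => ?_)).mono (by rw [Fintype.card_fin]; omega)
  simp only [BitVec.getLsbD_add i.2]
  exact derives_xor_xor (.inl (getLsbD_mem_of_bits_subset hξ i.2))
    (.inl (getLsbD_mem_of_bits_subset hη i.2)) (.inr ⟨i, i.2.le, rfl⟩)

theorem derives_ult {ξ : X → BitVec L} (hc : ∀ b, (fun _ => b) ∈ F) (hξ : bits ξ ⊆ F)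
    (t : BitVec L) : Derives F (4 * L + 1) {fun x => (ξ x).ult t} := by
  have hcarry := derives_carry (η := fun _ => ~~~t) true (hc true) hξ
    (Set.range_subset_iff.2 fun _ => hc _) le_rfl
  simp only [BitVec.ult_eq_not_carry]
  exact hcarry.trans (.gate (fun a _ => !a) (.inr ⟨L, Set.self_mem_Iic, rfl⟩) (.inl (hc true)))

theorem ofNat_val_add {Q : ℕ} [NeZero Q] (hQ : Q < 2 ^ L) (x v : ZMod Q) :
    BitVec.ofNat L (x + v).val = BitVec.ofNat L x.val +
      if (BitVec.ofNat L x.val).ult (BitVec.ofNat L (Q - v.val)) then BitVec.ofNat L v.val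
      else BitVec.ofNat L v.val - BitVec.ofNat L Q := by
  have hv := v.val_lt
  have hult : (BitVec.ofNat L x.val).ult (BitVec.ofNat L (Q - v.val)) = true ↔
      x.val + v.val < Q := by
    rw [BitVec.ult, decide_eq_true_iff, BitVec.toNat_ofNat, BitVec.toNat_ofNat,
      Nat.mod_eq_of_lt (x.val_lt.trans hQ), Nat.mod_eq_of_lt ((Nat.sub_le _ _).trans_lt hQ)]
    omega
  simp only [hult]
  split_ifs with h
  · rw [ZMod.val_add_of_lt h, BitVec.ofNat_add]
  · have hval := congrArg (BitVec.ofNat L) (ZMod.val_add_val_of_le (not_lt.1 h))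
    rw [BitVec.ofNat_add, BitVec.ofNat_add] at hval
    rw [← add_sub_assoc, hval, add_sub_cancel_right]

variable {Q : ℕ} [NeZero Q]

theorem derives_condAdd (hQ : Q < 2 ^ L) {ξ : X → ZMod Q} {β : X → Bool}
    (hc : ∀ b, (fun _ => b) ∈ F) (hξ : bits (fun x => BitVec.ofNat L (ξ x).val) ⊆ F) (hβ : β ∈ F)
    (v : ZMod Q) :
    Derives F (11 * L + 1)
      (bits fun x => BitVec.ofNat L (ξ x + if β x then v else 0).val) := by
  let t := BitVec.ofNat L (Q - v.val)
  let summand : Bool → Bool → BitVec L := fun b c =>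
    if b then if c then BitVec.ofNat L v.val else BitVec.ofNat L v.val - BitVec.ofNat L Q else 0
  let lt : X → Bool := fun x => (BitVec.ofNat L (ξ x).val).ult t
  have hlt : Derives F (4 * L + 1) {lt} := derives_ult hc hξ t
  have hsummand : Derives (F ∪ {lt}) L (bits fun x => summand (β x) (lt x)) :=
    (Derives.range fun i : Fin L =>
      .gate (fun b c => (summand b c).getLsbD i) (.inl hβ) (.inr rfl)).mono (by simp)
  have hadd := derives_add (.inl (.inl (hc false)))
    (hξ.trans (Set.subset_union_left.trans Set.subset_union_left))
    (Set.subset_union_right (s := F ∪ {lt}) (t := bits fun x => summand (β x) (lt x)))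
  have heq : (fun x => BitVec.ofNat L (ξ x + if β x then v else 0).val) =
      fun x => BitVec.ofNat L (ξ x).val + summand (β x) (lt x) := by
    funext x
    cases hb : β x
    · simp [summand]
    · simp only [if_true, ofNat_val_add hQ, summand, lt, t]
  rw [heq]
  exact (hlt.trans (hsummand.trans hadd)).mono (by omega)

theorem derives_affine (hQ : Q < 2 ^ L) {J : Type} (s : Finset J) {β : J → X → Bool}
    (hc : ∀ b, (fun _ => b) ∈ F) (hβ : ∀ j, β j ∈ F) (v₀ : ZMod Q) (v : J → ZMod Q) :
    Derives F (s.card * (11 * L + 1))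
      (bits fun x => BitVec.ofNat L (v₀ + ∑ j ∈ s, if β j x then v j else 0).val) := by
  classical
  induction s using Finset.induction_on with
  | empty => exact .done (Set.range_subset_iff.2 fun _ => by simpa using hc _)
  | insert a s ha ih =>
    have hsum (x : X) : v₀ + ∑ j ∈ insert a s, (if β j x then v j else 0) =
        (v₀ + ∑ j ∈ s, if β j x then v j else 0) + if β a x then v a else 0 := by
      rw [Finset.sum_insert ha, add_assoc, add_comm (ite _ _ _)]
    simp only [hsum, Finset.card_insert_of_notMem ha, add_one_mul]
    exact ih.trans (derives_condAdd hQ (fun b => .inl (hc b)) Set.subset_union_right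
      (.inl (hβ a)) (v a))

end Arithmetic

/-! ### Affine functions over a ring -/

section AffineFunctions

variable {R I : Type} [CommRing R]

variable (R I) in
/-- The functions `x ↦ c + ∑ i, w i * x i` on `I → R`, spanned by the constant `1` and the
coordinates. Everything that a simulator computes from its samples is of this form. -/
def affineFunctions : Submodule R ((I → R) → R) :=
  .span R (insert 1 (Set.range fun i x => x i))

theorem const_mem_affineFunctions (c : R) : (fun _ => c) ∈ affineFunctions R I := by
  convert (affineFunctions R I).smul_mem c (Submodule.subset_span (Set.mem_insert _ _)) using 1
  exact funext fun _ => (mul_one c).symm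

theorem apply_mem_affineFunctions (i : I) : (fun x => x i) ∈ affineFunctions R I :=
  Submodule.subset_span (.inr ⟨i, rfl⟩)

theorem sum_mem_affineFunctions {J : Type} (s : Finset J) {φ : J → (I → R) → R}
    (hφ : ∀ j, φ j ∈ affineFunctions R I) : (fun x => ∑ j ∈ s, φ j x) ∈ affineFunctions R I := by
  simpa only [Finset.sum_fn] using sum_mem fun j (_ : j ∈ s) => hφ j

theorem exists_eq_add_sum_of_mem_affineFunctions [Fintype I] {φ : (I → R) → R}
    (hφ : φ ∈ affineFunctions R I) : ∃ (c : R) (w : I → R), ∀ x, φ x = c + ∑ i, w i * x i := by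
  obtain ⟨c, ψ, hψ, rfl⟩ := Submodule.mem_span_insert.1 hφ
  obtain ⟨w, rfl⟩ := (Submodule.mem_span_range_iff_exists_fun R).1 hψ
  exact ⟨c, w, fun x => by simp⟩

end AffineFunctions

/-! ### Arithmetic in `R_Q` -/

theorem sum_testBit {n L : ℕ} (h : n < 2 ^ L) :
    ∑ k : Fin L, (if n.testBit k then 2 ^ (k : ℕ) else 0) = n := by
  rw [Fin.sum_univ_eq_sum_range (fun k => if n.testBit k then 2 ^ k else 0) L,
    ← Finset.sum_filter]
  convert Finset.sum_toFinset_bitIndices_two_pow n using 2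
  ext i
  have hi (hi : n.testBit i) : i < L :=
    (Nat.pow_lt_pow_iff_right Nat.one_lt_two).1 ((Nat.ge_two_pow_of_testBit hi).trans_lt h)
  simpa using hi

namespace RingParams

variable (P : RingParams)

theorem modulus_lt : P.modulus < 2 ^ P.bitLen := Nat.lt_size_self _

instance fact_one_lt_modulus : Fact (1 < P.modulus) := by
  obtain ⟨q, hq⟩ := P.nonempty
  exact ⟨(P.prime_of_mem q hq).one_lt.trans_le
    (Nat.le_of_dvd (Nat.pos_of_neZero P.modulus) (Finset.dvd_prod_of_mem _ hq))⟩

theorem natDegree_poly : P.poly.natDegree = P.dim :=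
  Polynomial.natDegree_X_pow_add_C

theorem coeff_add_sum_ite {J : Type} [Fintype J] (β : J → Bool) (v₀ : P.Rq) (v : J → P.Rq)
    (i : ℕ) : P.coeff (v₀ + ∑ j, if β j then v j else 0) i =
      P.coeff v₀ i + ∑ j, if β j then P.coeff (v j) i else 0 := by
  simp only [coeff, map_add, map_sum, Polynomial.coeff_add, Polynomial.finsetSum_coeff]
  congr! 2 with j
  split_ifs
  · rfl
  · rw [map_zero, Polynomial.coeff_zero]

/-- The contribution `2 ^ k * X ^ j` of the bit position `(j, k)` to the ring element which a
string of bits represents. -/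
def weight (p : P.Pos) : P.Rq :=
  AdjoinRoot.mk P.poly (Polynomial.C (2 ^ (p.2 : ℕ)) * Polynomial.X ^ (p.1 : ℕ))

theorem decode_eq_sum (b : P.Pos → Bool) : P.decode b = ∑ p, if b p then P.weight p else 0 := by
  simp only [decode, Fintype.sum_prod_type, map_sum, Finset.sum_mul]
  refine Finset.sum_congr rfl fun j _ => Finset.sum_congr rfl fun k _ => ?_
  split_ifs <;> simp [weight]

theorem sum_encode (x : P.Rq) (j : Fin P.dim) :
    (∑ k : Fin P.bitLen, if P.encode x (j, k) then (2 ^ (k : ℕ) : ZMod P.modulus) else 0) =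
      P.coeff x j := by
  have h := congrArg (Nat.cast : ℕ → ZMod P.modulus)
    (sum_testBit ((ZMod.val_lt (P.coeff x j)).trans P.modulus_lt))
  rw [ZMod.natCast_zmod_val] at h
  simp only [Nat.cast_sum, Nat.cast_ite, Nat.cast_pow, Nat.cast_ofNat, Nat.cast_zero] at h
  exact h

theorem natDegree_modByMonicHom_lt (x : P.Rq) :
    (AdjoinRoot.modByMonicHom P.poly_monic x).natDegree < P.dim := by
  obtain ⟨f, rfl⟩ := AdjoinRoot.mk_surjective x
  rw [AdjoinRoot.modByMonicHom_mk, ← P.natDegree_poly]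
  refine Polynomial.natDegree_modByMonic_lt _ P.poly_monic fun h => ?_
  have hdim : 0 < P.dim := Nat.two_pow_pos _
  rw [← P.natDegree_poly, h, Polynomial.natDegree_one] at hdim
  exact hdim.false

theorem decode_encode (x : P.Rq) : P.decode (P.encode x) = x := by
  simp only [decode, sum_encode, coeff]
  rw [Fin.sum_univ_eq_sum_range fun j => Polynomial.C
      ((AdjoinRoot.modByMonicHom P.poly_monic x).coeff j) * Polynomial.X ^ j,
    ← Polynomial.as_sum_range_C_mul_X_pow' _ (P.natDegree_modByMonicHom_lt x)]
  exact AdjoinRoot.mk_leftInverse P.poly_monic x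

/-- The cost of one bit of an affine function of `t` bits with values in `R_Q`: two constant
gates, and a conditional addition modulo `Q` for every one of the `t` bits. -/
def affineCost (t : ℕ) : ℕ := 2 + t * (11 * P.bitLen + 1)

theorem affineCost_mono : Monotone P.affineCost := fun _ _ h =>
  Nat.add_le_add_left (Nat.mul_le_mul_right _ h) 2

section Derives

variable {P} {X J : Type} [Fintype J] {F : Set (X → Bool)}

theorem derives_encode_add_sum_ite {β : J → X → Bool} (hβ : ∀ j, β j ∈ F) (v₀ : P.Rq)
    (v : J → P.Rq) (p : P.Pos) : Derives F (P.affineCost (Fintype.card J))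
      {fun x => P.encode (v₀ + ∑ j, if β j x then v j else 0) p} := by
  refine Derives.consts.trans ((derives_affine P.modulus_lt Finset.univ (fun b => .inr ⟨b, rfl⟩)
    (fun j => .inl (hβ j)) (P.coeff v₀ p.1) fun j => P.coeff (v j) p.1).subset ?_)
  refine Set.singleton_subset_iff.2 ⟨p.2, funext fun x => ?_⟩
  simp only [encode, coeff_add_sum_ite, BitVec.getLsbD_ofNat, p.2.2, decide_true, Bool.true_and]

variable {I : Type} [Fintype I] {φ : (I → P.Rq) → P.Rq} {t : ℕ}

theorem exists_eq_add_sum_encodeFam (hφ : φ ∈ affineFunctions P.Rq I) :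
    ∃ (v₀ : P.Rq) (v : I × P.Pos → P.Rq),
      ∀ x, φ x = v₀ + ∑ j, if P.encodeFam x j then v j else 0 := by
  obtain ⟨c, w, h⟩ := exists_eq_add_sum_of_mem_affineFunctions hφ
  refine ⟨c, fun j => w j.1 * P.weight j.2, fun x => ?_⟩
  have hx (i : I) : w i * x i = ∑ p, if P.encode (x i) p then w i * P.weight p else 0 := by
    conv_lhs => rw [← P.decode_encode (x i), decode_eq_sum, Finset.mul_sum]
    simp only [mul_ite, mul_zero]
  simp only [h, hx, Fintype.sum_prod_type (α₁ := I)]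
  rfl

theorem derives_encode (hφ : φ ∈ affineFunctions P.Rq I) (ht : Fintype.card I ≤ t) (p : P.Pos) :
    Derives (inputs P.encodeFam) (P.affineCost (t * (P.dim * P.bitLen)))
      {fun x => P.encode (φ x) p} := by
  obtain ⟨v₀, v, h⟩ := exists_eq_add_sum_encodeFam hφ
  simp only [h]
  refine (derives_encode_add_sum_ite (fun j => Set.mem_range_self j) v₀ v p).mono
    (P.affineCost_mono ?_)
  simp only [Fintype.card_prod, Fintype.card_fin]
  gcongr

theorem derives_encode_add_decode (hφ : φ ∈ affineFunctions P.Rq I) (ht : Fintype.card I < t)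
    (μ : (I → P.Rq) → P.Pos → Bool) (p : P.Pos) :
    Derives (inputs P.encodeFam ∪ inputs μ) (P.affineCost (t * (P.dim * P.bitLen)))
      {fun x => P.encode (φ x + P.decode (μ x)) p} := by
  obtain ⟨v₀, v, h⟩ := exists_eq_add_sum_encodeFam hφ
  have hsum (x : I → P.Rq) : φ x + P.decode (μ x) = v₀ + ∑ j : I × P.Pos ⊕ P.Pos,
      if Sum.elim (P.encodeFam x) (μ x) j then Sum.elim v P.weight j else 0 := by
    rw [h, decode_eq_sum, Fintype.sum_sum_type, add_assoc]
    rfl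
  simp only [hsum]
  have hβ : ∀ j : I × P.Pos ⊕ P.Pos, (fun x => Sum.elim (P.encodeFam x) (μ x) j) ∈
      inputs P.encodeFam ∪ inputs μ
    | .inl j => .inl ⟨j, rfl⟩
    | .inr q => .inr ⟨q, rfl⟩
  refine (derives_encode_add_sum_ite hβ v₀ _ p).mono (P.affineCost_mono ?_)
  simp only [Fintype.card_sum, Fintype.card_prod, Fintype.card_fin, ← Nat.succ_mul]
  gcongr
  exact ht

end Derives

end RingParams

/-! ### Independent samples -/

section Sampling

variable {α β γ : Type}

theorem monad_bind_eq_bind (p : PMF α) (q : α → PMF β) : p >>= q = p.bind q := rfl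

theorem monad_pure_eq_pure (a : α) : (pure a : PMF α) = PMF.pure a := rfl

theorem eq_bind_map_of_equiv {p : PMF α} {q : PMF β} {r : PMF γ} (e : α ≃ β × γ)
    (h : ∀ a, p a = q (e a).1 * r (e a).2) :
    p = q.bind fun b => r.map fun c => e.symm (b, c) := by
  classical
  ext a
  have hpoint (b : β) (c : γ) : (a = e.symm (b, c)) ↔ ((e a).1 = b ∧ (e a).2 = c) := by
    rw [Equiv.eq_symm_apply, Prod.ext_iff]
  simp only [PMF.bind_apply, PMF.map_apply, hpoint, h]
  rw [tsum_eq_single (e a).1, tsum_eq_single (e a).2]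
  · simp
  · intro c hc
    simp [hc.symm]
  · intro b hb
    simp [hb.symm]

theorem map_uniformOfFintype [Fintype α] [Nonempty α] (e : α ≃ α) :
    (PMF.uniformOfFintype α).map e = PMF.uniformOfFintype α := by
  classical
  ext a
  rw [PMF.map_apply, tsum_eq_single (e.symm a)]
  · simp
  · intro b hb
    rw [if_neg fun h => hb ((Equiv.symm_apply_eq e).2 h).symm]

variable [Fintype α] {ι κ : Type} [Fintype ι] [Fintype κ] (p : PMF α)

theorem iid_apply (f : ι → α) : iid ι p f = ∏ i, p (f i) := rfl

theorem iid_sum : iid (ι ⊕ κ) p = (iid ι p).bind fun x => (iid κ p).map fun y => Sum.elim x y :=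
  eq_bind_map_of_equiv (Equiv.sumArrowEquivProdArrow ι κ α) fun f => by
    rw [iid_apply, Fintype.prod_sum_type]
    rfl

theorem iid_zero : iid (Fin 0) p = PMF.pure ![] := by
  ext f
  simp [iid_apply, Subsingleton.elim f ![], PMF.pure_apply]

theorem iid_succ (n : ℕ) :
    iid (Fin (n + 1)) p = p.bind fun x => (iid (Fin n) p).map fun y => Fin.cons x y :=
  eq_bind_map_of_equiv (Fin.consEquiv fun _ => α).symm fun f => by
    rw [iid_apply, Fin.prod_univ_succ]
    rfl

theorem iid_one : iid (Fin 1) p = p.map fun x => ![x] := by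
  rw [iid_succ, iid_zero]
  simp only [PMF.pure_map]
  rfl

theorem iid_two : iid (Fin 2) p = p.bind fun x => p.map fun y => ![x, y] := by
  rw [iid_succ, iid_one]
  simp only [PMF.map_comp]
  rfl

theorem iid_eq_bind_map_update [DecidableEq ι] (h : ι) :
    iid ι p = (iid ι p).bind fun g => p.map (Function.update g h) := by
  have hsplit : iid ι p = p.bind fun x => (iid {i // i ≠ h} p).map fun y =>
      (Equiv.funSplitAt h α).symm (x, y) :=
    eq_bind_map_of_equiv (Equiv.funSplitAt h α) fun f => by
      rw [iid_apply, Fintype.prod_eq_mul_prod_compl h,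
        Finset.prod_subtype _ (p := (· ≠ h)) fun i => by simp]
      rfl
  have hupdate (x x' : α) (y : {i // i ≠ h} → α) :
      Function.update ((Equiv.funSplitAt h α).symm (x, y)) h x' =
        (Equiv.funSplitAt h α).symm (x', y) := by
    ext i
    by_cases hi : i = h
    · subst hi; simp
    · simp [hi]
  calc iid ι p
      = (iid {i // i ≠ h} p).bind fun y => p.map fun x' =>
          (Equiv.funSplitAt h α).symm (x', y) := by
        simp only [hsplit, ← PMF.bind_pure_comp, Function.comp_def]
        rw [PMF.bind_comm]
    _ = (iid ι p).bind fun g => p.map (Function.update g h) := by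
        simp only [hsplit, ← PMF.bind_pure_comp, PMF.bind_bind, PMF.pure_bind, Function.comp_def,
          hupdate, PMF.bind_const]

end Sampling

/-! ### Distinguishing gaps -/

/-- The distance between the probabilities with which two games return `true`. -/
def gap (p q : PMF Bool) : ℝ := |(p true).toReal - (q true).toReal|

theorem gap_triangle (p q r : PMF Bool) : gap p r ≤ gap p q + gap q r :=
  abs_sub_le _ _ _

theorem advantage_eq_gap (game : PMF Bool) :
    advantage game = gap game (PMF.uniformOfFintype Bool) := by
  simp [advantage, gap]

theorem toReal_bind_apply {α β : Type} [Fintype α] (p : PMF α) (q : α → PMF β) (b : β) :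
    (p.bind q b).toReal = ∑ a, (p a).toReal * (q a b).toReal := by
  rw [PMF.bind_apply, tsum_fintype, ENNReal.toReal_sum
    fun a _ => ENNReal.mul_ne_top (p.apply_ne_top a) ((q a).apply_ne_top b)]
  simp only [ENNReal.toReal_mul]

theorem exists_gap_bind_le {α : Type} [Finite α] (p : PMF α) (q q' : α → PMF Bool) :
    ∃ a, gap (p.bind q) (p.bind q') ≤ gap (q a) (q' a) := by
  have := Fintype.ofFinite α
  have := p.support_nonempty.to_type
  obtain ⟨a, ha⟩ := Finite.exists_max fun a => gap (q a) (q' a)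
  have hp : ∑ b, (p b).toReal = 1 := by
    rw [← ENNReal.toReal_sum fun b _ => p.apply_ne_top b, ← tsum_fintype (L := .unconditional _),
      p.tsum_coe, ENNReal.toReal_one]
  refine ⟨a, ?_⟩
  calc gap (p.bind q) (p.bind q')
      = |∑ b, (p b).toReal * ((q b true).toReal - (q' b true).toReal)| := by
        simp only [gap, toReal_bind_apply, ← Finset.sum_sub_distrib, mul_sub]
    _ ≤ ∑ b, (p b).toReal * gap (q b) (q' b) := by
        refine (Finset.abs_sum_le_sum_abs _ _).trans_eq (Finset.sum_congr rfl fun b _ => ?_)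
        rw [abs_mul, abs_of_nonneg ENNReal.toReal_nonneg, gap]
    _ ≤ ∑ b, (p b).toReal * gap (q a) (q' a) :=
        Finset.sum_le_sum fun b _ => mul_le_mul_of_nonneg_left (ha b) ENNReal.toReal_nonneg
    _ = gap (q a) (q' a) := by rw [← Finset.sum_mul, hp, one_mul]

/-- The distinguishing problem between `g` and `g'` reduces to that between the tuples `d` and
`d'` of ring elements: some circuit of cost at most `K` has at least the advantage `gap g g'`. -/
def Reduces (P : RingParams) {I : Type} (d d' : PMF (I → P.Rq)) (K : ℕ) (g g' : PMF Bool) : Prop :=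
  ∃ D : Circuit (I × P.Pos) Unit, D.cost ≤ K ∧ gap g g' ≤ |acceptProb P D d - acceptProb P D d'|

namespace Reduces

variable {P : RingParams} {I : Type} {K : ℕ}

-- An average over auxiliary randomness is at most its largest term, which is hard-wired into the
-- distinguisher.
theorem bind {d d' : PMF (I → P.Rq)} {α : Type} [Finite α] (p : PMF α) {q q' : α → PMF Bool}
    (h : ∀ a, Reduces P d d' K (q a) (q' a)) : Reduces P d d' K (p.bind q) (p.bind q') := by
  obtain ⟨a, ha⟩ := exists_gap_bind_le p q q'
  obtain ⟨D, hD, hle⟩ := h a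
  exact ⟨D, hD, ha.trans hle⟩

theorem bind_left {d d' : PMF (I → P.Rq)} {α : Type} [Finite α] (p : PMF α) {q : α → PMF Bool}
    {g : PMF Bool} (h : ∀ a, Reduces P d d' K (q a) g) : Reduces P d d' K (p.bind q) g := by
  simpa only [PMF.bind_const] using bind p h

theorem map_of_derives (d d' : PMF (I → P.Rq)) {f : (I → P.Rq) → Bool}
    (h : Derives (inputs P.encodeFam) K {f}) : Reduces P d d' K (d.map f) (d'.map f) := by
  obtain ⟨D, hD, hf⟩ := h.exists_circuit _
  have haccept (d : PMF (I → P.Rq)) : acceptProb P D d = (d.map f true).toReal := by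
    simp only [acceptProb, hf]
    rfl
  exact ⟨D, hD, by rw [haccept, haccept]; rfl⟩

end Reduces

/-! ### Strategies -/

/-- A chosen-plaintext adversary without coins. No state is passed between its stages, because the
second stage can recompute everything the first one knew. -/
structure Strategy {P : Params} (S : Finset (Fin P.parties)) where
  msg : (ViewIdx S → P.Rq) → Bool × P.Pos → Bool
  guess : (ViewIdx S ⊕ Fin 2 → P.Rq) → Bool

/-- The bound on the cost of simulating the game of a strategy of cost `c`: the strategy is
evaluated twice, with its inputs recomputed for every gate as affine functions of at most four
ring elements and one decoded plaintext. -/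
def simCost (P : RingParams) (c : ℕ) : ℕ :=
  2 * (c * (2 * P.affineCost (5 * (P.dim * P.bitLen)) + 1)) +
    (P.dim * P.bitLen + 1) * P.affineCost (5 * (P.dim * P.bitLen)) + 1

/-- Turns an encryption of zero under an additively masking scheme, preceded by other data, into
an encryption of `m`. -/
def addPlaintext {ι R : Type} [Ring R] (v : ι ⊕ Fin 2 → R) (m : R) : ι ⊕ Fin 2 → R :=
  Sum.elim (fun t => v (.inl t)) ((fun i => v (.inr i)) + ![m, 0])

theorem addPlaintext_inr_one {ι R : Type} [Ring R] (v : ι ⊕ Fin 2 → R) (m : R) :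
    addPlaintext v m (.inr 1) = v (.inr 1) :=
  add_zero _

namespace Strategy

variable {P : Params} {S : Finset (Fin P.parties)} (σ : Strategy S) {c : ℕ}

/-- Both stages of a strategy are computed from binary encodings with at most `c` gates. -/
def CostLE (c : ℕ) : Prop :=
  Derives (inputs P.encodeFam) c (inputs σ.msg) ∧ Derives (inputs P.encodeFam) c {σ.guess}

/-- Whether the strategy wins against the challenge bit `b`, given its view and an encryption of
zero to which its plaintext is added. -/
def win (b : Bool) (v : ViewIdx S ⊕ Fin 2 → P.Rq) : Bool :=
  σ.guess (addPlaintext v (P.decode fun p => σ.msg (fun t => v (.inl t)) (b, p))) == b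

/-- The chosen-plaintext game against a strategy, where `d` is the joint distribution of the view
and an encryption of zero. -/
def game (d : PMF (ViewIdx S ⊕ Fin 2 → P.Rq)) : PMF Bool :=
  (PMF.uniformOfFintype Bool).bind fun b => d.map (σ.win b)

variable {σ} in
theorem CostLE.derives_win (hσ : σ.CostLE c) {I : Type} [Fintype I] (hI : Fintype.card I ≤ 4)
    {sim : (I → P.Rq) → ViewIdx S ⊕ Fin 2 → P.Rq}
    (hsim : ∀ t, (fun x => sim x t) ∈ affineFunctions P.Rq I) (b : Bool) :
    Derives (inputs P.encodeFam) (simCost P.toRingParams c) {fun x => σ.win b (sim x)} := by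
  set A := P.affineCost (5 * (P.dim * P.bitLen)) with hA
  let μ (x : I → P.Rq) (p : P.Pos) : Bool := σ.msg (fun t => sim x (.inl t)) (b, p)
  have hencode (t : ViewIdx S ⊕ Fin 2) (p : P.Pos) :
      Derives (inputs P.encodeFam) A {fun x => P.encode (sim x t) p} :=
    RingParams.derives_encode (hsim t) (hI.trans (Nat.le_succ 4)) p
  have hinput : ∀ t p, Derives (inputs P.encodeFam ∪ inputs μ) A
      {fun x => P.encode (addPlaintext (sim x) (P.decode (μ x)) t) p}
    | .inl t, p => (hencode (.inl t) p).of_subset Set.subset_union_left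
    | .inr 0, p => RingParams.derives_encode_add_decode (hsim _) (Nat.lt_succ_of_le hI) μ p
    | .inr 1, p => by
      simpa only [addPlaintext_inr_one] using
        (hencode (.inr 1) p).of_subset Set.subset_union_left
  have hmsg : Derives (inputs P.encodeFam) (c * (2 * A + 1) + Fintype.card P.Pos * A) (inputs μ) :=
    hσ.1.comp (fun x t => sim x (.inl t)) (Set.forall_mem_range.2 fun q => hencode _ q.2)
      (g := fun p v => σ.msg v (b, p)) fun p => Set.mem_range_self (b, p)
  have hguess : Derives (inputs P.encodeFam ∪ inputs μ) (c * (2 * A + 1) + Fintype.card Unit * A)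
      (Set.range fun _ : Unit => σ.guess ∘ fun x => addPlaintext (sim x) (P.decode (μ x))) :=
    hσ.2.comp _ (Set.forall_mem_range.2 fun q => hinput q.1 q.2) fun _ => rfl
  refine ((hmsg.trans hguess).trans (.gate (fun y _ => y == b) (.inr ⟨(), rfl⟩)
    (.inr ⟨(), rfl⟩))).mono ?_
  simp only [simCost, ← hA, Fintype.card_prod, Fintype.card_fin, Fintype.card_unit]
  exact le_of_eq (by ring)

end Strategy

/-! ### Simulating the view of the coalition -/

theorem rlweSamples_eq_bind (P : RingParams) (secret err : PMF P.Rq) (m : ℕ) :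
    rlweSamples P secret err m = secret.bind fun s =>
      (iid (Fin m) (PMF.uniformOfFintype P.Rq)).bind fun a =>
        (iid (Fin m) err).map fun e => Sum.elim a fun i => a i * s + e i :=
  rfl

namespace Params

variable (P : Params)

/-- The randomness `(u, (e₀, e₁))` of encryption. -/
def encCoins : PMF (P.Rq × (Fin 2 → P.Rq)) :=
  P.encDist.bind fun u => (iid (Fin 2) P.errDist).map fun e => (u, e)

/-- The encryption of zero with given randomness. -/
def encZero (pk : P.Rq × P.Rq) (r : P.Rq × (Fin 2 → P.Rq)) : P.Rq × P.Rq :=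
  (r.1 * pk.1 + r.2 0, r.1 * pk.2 + r.2 1)

theorem enc_eq_map (pk : P.Rq × P.Rq) (m : P.Rq) :
    P.enc pk m = P.encCoins.map fun r => P.encZero pk r + (m, 0) := by
  simp only [enc, encCoins, iid_two, monad_bind_eq_bind, monad_pure_eq_pure, PMF.bind_bind,
    PMF.pure_bind, ← PMF.bind_pure_comp, Function.comp_def, encZero, Prod.mk_add_mk, add_zero,
    Matrix.cons_val_zero, Matrix.cons_val_one]

variable (S : Finset (Fin P.parties))

/-- The joint distribution of the view of `S` and an encryption of zero. -/
def zeroView : PMF (ViewIdx S ⊕ Fin 2 → P.Rq) :=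
  P.setup.bind fun k => P.encCoins.map fun r => P.viewWith S k (P.encZero (P.cpk k) r)

variable {P}

/-- The sum of the public keys of all parties but `h`. -/
def otherKeys (h : Fin P.parties) (g : Fin P.parties → P.Rq × P.Rq) (a : P.Rq) : P.Rq :=
  ∑ i ∈ Finset.univ \ {h}, (P.publicKey a (g i)).1

/-- The first components of the public keys when those of all parties but `h` are computed from
their secrets `g`, and `-c` is used for `h`: the genuine key if `c` is the second component of an
RLWE sample, and a uniformly random one if `c` is uniform. -/
def simKeys (h : Fin P.parties) (g : Fin P.parties → P.Rq × P.Rq) (a c : P.Rq) :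
    Fin P.parties → P.Rq :=
  Function.update (fun i => (P.publicKey a (g i)).1) h (-c)

/-- The view of `S` when the public keys are `simKeys`. -/
def simView (h : Fin P.parties) (g : Fin P.parties → P.Rq × P.Rq) (a c : P.Rq) :
    ViewIdx S → P.Rq
  | .crs => a
  | .cpk => ∑ i, simKeys h g a c i
  | .pk i => simKeys h g a c i
  | .sk i => (g i).1
  | .err i => (g i).2

/-- The simulation of `zeroView` from one sample `(a, c)`, which determines the key of `h`. -/
def keySim (h : Fin P.parties) (g : Fin P.parties → P.Rq × P.Rq) (r : P.Rq × (Fin 2 → P.Rq))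
    (x : SampleIdx 1 → P.Rq) : ViewIdx S ⊕ Fin 2 → P.Rq :=
  Sum.elim (simView S h g (x (.inl 0)) (x (.inr 0)))
    ![r.1 * (∑ i, simKeys h g (x (.inl 0)) (x (.inr 0)) i) + r.2 0, r.1 * x (.inl 0) + r.2 1]

/-- The simulation of the view and an encryption of zero from two samples `(p, c₀)`, `(a, c₁)`:
the key of `h` is chosen such that the collective key is `(p, a)`, and `(c₀, c₁)` is the
ciphertext. -/
def encSim (h : Fin P.parties) (g : Fin P.parties → P.Rq × P.Rq) (x : SampleIdx 2 → P.Rq) :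
    ViewIdx S ⊕ Fin 2 → P.Rq :=
  Sum.elim (simView S h g (x (.inl 1)) (otherKeys h g (x (.inl 1)) - x (.inl 0)))
    fun i => x (.inr i)

variable {S}

theorem sum_simKeys (h : Fin P.parties) (g : Fin P.parties → P.Rq × P.Rq) (a c : P.Rq) :
    ∑ i, simKeys h g a c i = otherKeys h g a - c := by
  rw [simKeys, Finset.sum_update_of_mem (Finset.mem_univ h), otherKeys, neg_add_eq_sub]

theorem viewWith_update_eq_keySim {h : Fin P.parties} (hh : h ∉ S) (a : P.Rq)
    (g : Fin P.parties → P.Rq × P.Rq) (se : P.Rq × P.Rq) (r : P.Rq × (Fin 2 → P.Rq)) :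
    P.viewWith S (a, Function.update g h se) (P.encZero (P.cpk (a, Function.update g h se)) r) =
      keySim S h g r (Sum.elim ![a] fun i => ![a] i * se.1 + ![se.2] i) := by
  have hkeys (i : Fin P.parties) :
      (P.publicKeys (a, Function.update g h se) i).1 = simKeys h g a (a * se.1 + se.2) i :=
    Function.apply_update (fun _ se => (P.publicKey a se).1) g h se i
  have hcpk : P.cpk (a, Function.update g h se) = (∑ i, simKeys h g a (a * se.1 + se.2) i, a) := by
    simp only [cpk, collectiveKey, hkeys]
  have hview : P.view S (a, Function.update g h se) = simView S h g a (a * se.1 + se.2) := by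
    funext t
    cases t with
    | crs => rfl
    | cpk => exact congrArg Prod.fst hcpk
    | pk i => exact hkeys i
    | sk i | err i =>
      simp only [view, simView, Function.update_of_ne fun hi : i.1 = h => hh (hi ▸ i.2)]
  simp only [viewWith, hview, hcpk]
  rfl

theorem zeroView_eq {h : Fin P.parties} (hh : h ∉ S) :
    P.zeroView S = (iid (Fin P.parties) P.keySecrets).bind fun g => P.encCoins.bind fun r =>
      (rlweSamples P.toRingParams P.keyDist P.errDist 1).map (keySim S h g r) := by
  have hsetup : P.setup = (PMF.uniformOfFintype P.Rq).bind fun a =>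
      (iid (Fin P.parties) P.keySecrets).bind fun g => P.keyDist.bind fun s =>
        P.errDist.map fun e => (a, Function.update g h (s, e)) := by
    conv_lhs => rw [setup, iid_eq_bind_map_update _ h]
    simp only [keySecrets, monad_bind_eq_bind, monad_pure_eq_pure, PMF.bind_bind, PMF.pure_bind,
      ← PMF.bind_pure_comp, Function.comp_def]
  simp only [zeroView, hsetup, rlweSamples_eq_bind, iid_one, ← PMF.bind_pure_comp, PMF.bind_bind,
    PMF.pure_bind, Function.comp_def, viewWith_update_eq_keySim hh]
  rw [PMF.bind_comm]
  refine congrArg _ (funext fun g => ?_)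
  simp only [PMF.bind_comm P.errDist P.encCoins, PMF.bind_comm P.keyDist P.encCoins]
  rw [PMF.bind_comm _ P.encCoins]
  refine congrArg _ (funext fun r => ?_)
  rw [PMF.bind_comm]

theorem map_keySim_uniformSamples (h : Fin P.parties) (g : Fin P.parties → P.Rq × P.Rq) :
    (P.encCoins.bind fun r => (uniformSamples P.toRingParams 1).map (keySim S h g r)) =
      (rlweSamples P.toRingParams P.encDist P.errDist 2).map (encSim S h g) := by
  have hsub (a : P.Rq) (f : P.Rq → PMF (ViewIdx S ⊕ Fin 2 → P.Rq)) :
      (PMF.uniformOfFintype P.Rq).bind f =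
        (PMF.uniformOfFintype P.Rq).bind fun p => f (otherKeys h g a - p) := by
    conv_lhs => rw [← map_uniformOfFintype (Equiv.subLeft (otherKeys h g a)), PMF.bind_map]
    rfl
  have hsim (u a p : P.Rq) (e : Fin 2 → P.Rq) :
      keySim S h g (u, e) (Sum.elim ![a] ![otherKeys h g a - p]) =
        encSim S h g (Sum.elim ![p, a] fun i => ![p, a] i * u + e i) := by
    simp only [keySim, encSim, sum_simKeys, mul_comm u, Sum.elim_inl, Sum.elim_inr,
      Matrix.cons_val_zero, Matrix.cons_val_one, sub_sub_cancel]
    exact congrArg _ (funext (Fin.forall_fin_two.2 ⟨rfl, rfl⟩))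
  simp only [encCoins, uniformSamples, rlweSamples_eq_bind, iid_sum, iid_one,
    iid_two (PMF.uniformOfFintype P.Rq), ← PMF.bind_pure_comp, PMF.bind_bind, PMF.pure_bind,
    Function.comp_def]
  refine congrArg _ (funext fun u => ?_)
  simp only [PMF.bind_comm (iid (Fin 2) P.errDist)]
  conv_rhs => rw [PMF.bind_comm]
  refine congrArg _ (funext fun a => ?_)
  rw [hsub a]
  simp only [hsim]

section AffineFunctions

variable {I : Type} {α γ : (I → P.Rq) → P.Rq}

theorem publicKey_mem_affineFunctions (hα : α ∈ affineFunctions P.Rq I) (se : P.Rq × P.Rq) :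
    (fun x => (P.publicKey (α x) se).1) ∈ affineFunctions P.Rq I := by
  simp only [publicKey, mul_comm _ se.1]
  exact neg_mem (add_mem (Submodule.smul_mem _ se.1 hα) (const_mem_affineFunctions se.2))

theorem simKeys_mem_affineFunctions (h : Fin P.parties) (g : Fin P.parties → P.Rq × P.Rq)
    (hα : α ∈ affineFunctions P.Rq I) (hγ : γ ∈ affineFunctions P.Rq I) (i : Fin P.parties) :
    (fun x => simKeys h g (α x) (γ x) i) ∈ affineFunctions P.Rq I := by
  rcases eq_or_ne i h with rfl | hi
  · simp only [simKeys, Function.update_self]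
    exact neg_mem hγ
  · simpa only [simKeys, Function.update_of_ne hi] using publicKey_mem_affineFunctions hα (g i)

theorem simView_mem_affineFunctions (h : Fin P.parties) (g : Fin P.parties → P.Rq × P.Rq)
    (hα : α ∈ affineFunctions P.Rq I) (hγ : γ ∈ affineFunctions P.Rq I) :
    ∀ t, (fun x => simView S h g (α x) (γ x) t) ∈ affineFunctions P.Rq I
  | .crs => hα
  | .cpk => sum_mem_affineFunctions _ (simKeys_mem_affineFunctions h g hα hγ)
  | .pk i => simKeys_mem_affineFunctions h g hα hγ i
  | .sk i => const_mem_affineFunctions (g i).1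
  | .err i => const_mem_affineFunctions (g i).2

theorem keySim_mem_affineFunctions (h : Fin P.parties) (g : Fin P.parties → P.Rq × P.Rq)
    (r : P.Rq × (Fin 2 → P.Rq)) :
    ∀ t, (fun x => keySim S h g r x t) ∈ affineFunctions P.Rq (SampleIdx 1)
  | .inl t => simView_mem_affineFunctions h g (apply_mem_affineFunctions _)
      (apply_mem_affineFunctions _) t
  | .inr 0 => add_mem (Submodule.smul_mem _ r.1 (sum_mem_affineFunctions _
      (simKeys_mem_affineFunctions h g (apply_mem_affineFunctions _)
        (apply_mem_affineFunctions _)))) (const_mem_affineFunctions _)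
  | .inr 1 => add_mem (Submodule.smul_mem _ r.1 (apply_mem_affineFunctions _))
      (const_mem_affineFunctions _)

theorem encSim_mem_affineFunctions (h : Fin P.parties) (g : Fin P.parties → P.Rq × P.Rq) :
    ∀ t, (fun x => encSim S h g x t) ∈ affineFunctions P.Rq (SampleIdx 2)
  | .inl t => simView_mem_affineFunctions h g (apply_mem_affineFunctions _)
      (sub_mem (sum_mem_affineFunctions _ fun i =>
        publicKey_mem_affineFunctions (apply_mem_affineFunctions _) (g i))
        (apply_mem_affineFunctions _)) t
  | .inr i => apply_mem_affineFunctions (Sum.inr i)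

end AffineFunctions

end Params

/-! ### The hybrid argument -/

theorem iid_uniformOfFintype {ι α : Type} [Fintype ι] [DecidableEq ι] [Fintype α] [Nonempty α] :
    iid ι (PMF.uniformOfFintype α) = PMF.uniformOfFintype (ι → α) := by
  ext f
  simp [iid_apply, ENNReal.inv_pow]

-- Perfect secrecy of the one-time pad.
theorem uniformOfFintype_bind_map_add_beq {G : Type} [AddGroup G] [Fintype G] (f : G → Bool)
    (m : Bool → G) :
    ((PMF.uniformOfFintype Bool).bind fun b =>
      (PMF.uniformOfFintype G).map fun c => f (c + m b) == b) = PMF.uniformOfFintype Bool := by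
  have hpad (b : Bool) : ((PMF.uniformOfFintype G).map fun c => f (c + m b) == b) =
      (PMF.uniformOfFintype G).map fun c => f c == b := by
    conv_rhs => rw [← map_uniformOfFintype (Equiv.addRight (m b)), PMF.map_comp]
    rfl
  have hguess (y : Bool) :
      (PMF.uniformOfFintype Bool).map (y == ·) = PMF.uniformOfFintype Bool :=
    map_uniformOfFintype (Function.Involutive.toPerm (y == ·)
      (by cases y <;> rintro (_ | _) <;> rfl))
  simp only [hpad, ← PMF.bind_pure_comp, Function.comp_def]
  rw [PMF.bind_comm]
  simp only [← Function.comp_def PMF.pure, PMF.bind_pure_comp, hguess, PMF.bind_const]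

namespace Strategy

variable {P : Params} {S : Finset (Fin P.parties)} (σ : Strategy S) {c : ℕ}

theorem game_bind {α : Type} (p : PMF α) (d : α → PMF (ViewIdx S ⊕ Fin 2 → P.Rq)) :
    σ.game (p.bind d) = p.bind fun a => σ.game (d a) := by
  simp only [game, PMF.map_bind]
  rw [PMF.bind_comm]

variable {σ} in
theorem CostLE.reduces_game_map (hσ : σ.CostLE c) {I : Type} [Fintype I]
    (hI : Fintype.card I ≤ 4) {sim : (I → P.Rq) → ViewIdx S ⊕ Fin 2 → P.Rq}
    (hsim : ∀ t, (fun x => sim x t) ∈ affineFunctions P.Rq I) (d d' : PMF (I → P.Rq)) :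
    Reduces P.toRingParams d d' (simCost P.toRingParams c)
      (σ.game (d.map sim)) (σ.game (d'.map sim)) := by
  simp only [game, PMF.map_comp]
  exact .bind _ fun b => .map_of_derives d d' (hσ.derives_win hI hsim b)

/-- The joint distribution of the view and an encryption of zero when the key of `h` is uniform. -/
def hybrid (S : Finset (Fin P.parties)) (h : Fin P.parties) : PMF (ViewIdx S ⊕ Fin 2 → P.Rq) :=
  (iid (Fin P.parties) P.keySecrets).bind fun g => P.encCoins.bind fun r =>
    (uniformSamples P.toRingParams 1).map (Params.keySim S h g r)

variable {σ} in
theorem CostLE.reduces_key (hσ : σ.CostLE c) {h : Fin P.parties} (hh : h ∉ S) :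
    Reduces P.toRingParams (rlweSamples P.toRingParams P.keyDist P.errDist 1)
      (uniformSamples P.toRingParams 1) (simCost P.toRingParams c)
      (σ.game (P.zeroView S)) (σ.game (hybrid S h)) := by
  rw [P.zeroView_eq hh, hybrid]
  simp only [game_bind]
  exact .bind _ fun g => .bind _ fun r =>
    hσ.reduces_game_map (by simp) (Params.keySim_mem_affineFunctions h g r) _ _

theorem game_map_encSim_uniformSamples (h : Fin P.parties) (g : Fin P.parties → P.Rq × P.Rq) :
    σ.game ((uniformSamples P.toRingParams 2).map (Params.encSim S h g)) =
      PMF.uniformOfFintype Bool := by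
  have hsim (a b : Fin 2 → P.Rq) : Params.encSim S h g (Sum.elim a b) =
      Sum.elim (Params.simView S h g (a 1) (Params.otherKeys h g (a 1) - a 0)) b := rfl
  have hpad (v : ViewIdx S → P.Rq) :
      σ.game ((PMF.uniformOfFintype (Fin 2 → P.Rq)).map (Sum.elim v)) =
        PMF.uniformOfFintype Bool := by
    simp only [game, PMF.map_comp]
    exact uniformOfFintype_bind_map_add_beq (fun c => σ.guess (Sum.elim v c))
      fun b => ![P.decode fun p => σ.msg v (b, p), 0]
  rw [uniformSamples, iid_sum, PMF.map_bind, game_bind]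
  simp only [PMF.map_comp, Function.comp_def, hsim, iid_uniformOfFintype, hpad, PMF.bind_const]

variable {σ} in
theorem CostLE.reduces_enc (hσ : σ.CostLE c) (h : Fin P.parties) :
    Reduces P.toRingParams (rlweSamples P.toRingParams P.encDist P.errDist 2)
      (uniformSamples P.toRingParams 2) (simCost P.toRingParams c)
      (σ.game (hybrid S h)) (PMF.uniformOfFintype Bool) := by
  rw [hybrid, game_bind]
  simp only [Params.map_keySim_uniformSamples]
  exact .bind_left _ fun g => by
    simpa only [game_map_encSim_uniformSamples] using
      hσ.reduces_game_map (by simp) (Params.encSim_mem_affineFunctions h g)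
        (rlweSamples P.toRingParams P.encDist P.errDist 2) (uniformSamples P.toRingParams 2)

end Strategy

/-! ### Adversaries as randomized strategies -/

section Adversaries

variable {P : Params} {S : Finset (Fin P.parties)}

/-- The strategy which plays fixed messages and guesses by a circuit with fixed coins. -/
def fixedStrategy (m₁ m₂ : P.Rq) (A : Circuit ((ViewIdx S ⊕ Fin 2) × P.Pos) Unit)
    (r : Fin A.coins → Bool) : Strategy S where
  msg _ q := P.encode (if q.1 then m₂ else m₁) q.2
  guess v := A.eval (P.encodeFam v) r ()

theorem costLE_fixedStrategy (m₁ m₂ : P.Rq) (A : Circuit ((ViewIdx S ⊕ Fin 2) × P.Pos) Unit)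
    (r : Fin A.coins → Bool) : (fixedStrategy m₁ m₂ A r).CostLE (2 + A.cost) := by
  refine ⟨Derives.consts.weaken subset_rfl ?_ (Nat.le_add_right 2 _),
    (A.derives r P.encodeFam).subset ?_⟩
  · rintro _ ⟨q, rfl⟩
    exact ⟨_, rfl⟩
  · exact Set.singleton_subset_iff.2 ⟨(), rfl⟩

/-- The strategy of a chosen-plaintext adversary with fixed coins. -/
def Params.Adversary.strategy (A : P.Adversary S)
    (r : (Fin A.choose.coins → Bool) × (Fin A.guess.coins → Bool)) : Strategy S where
  msg v q := A.choose.eval (P.encodeFam v) r.1 (.inl q)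
  guess v := A.guess.eval (Sum.elim (P.encodeFam v) fun i =>
    A.choose.eval (P.encodeFam fun t => v (.inl t)) r.1 (.inr i)) r.2 ()

theorem Params.Adversary.costLE_strategy (A : P.Adversary S)
    (r : (Fin A.choose.coins → Bool) × (Fin A.guess.coins → Bool)) :
    (A.strategy r).CostLE (4 + A.cost) := by
  have hcost : A.choose.cost + A.guess.cost ≤ A.cost := by
    rw [cost, add_assoc]
    exact Nat.le_add_left _ _
  have hchoose := A.choose.derives r.1 fun v : ViewIdx S ⊕ Fin 2 → P.Rq =>
    P.encodeFam fun t => v (.inl t)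
  have hguess := A.guess.derives r.2 fun v : ViewIdx S ⊕ Fin 2 → P.Rq =>
    Sum.elim (P.encodeFam v) fun i => A.choose.eval (P.encodeFam fun t => v (.inl t)) r.1 (.inr i)
  refine ⟨(A.choose.derives r.1 P.encodeFam).weaken subset_rfl ?_ (by omega),
    ((hchoose.of_subset ?_).trans (hguess.weaken ?_ ?_ le_rfl)).mono (by omega)⟩
  · rintro _ ⟨q, rfl⟩
    exact ⟨.inl q, rfl⟩
  · rintro _ ⟨⟨t, p⟩, rfl⟩
    exact ⟨(.inl t, p), rfl⟩
  · rintro _ ⟨p | i, rfl⟩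
    · exact .inl ⟨p, rfl⟩
    · exact .inr ⟨.inr i, rfl⟩
  · exact Set.singleton_subset_iff.2 ⟨(), rfl⟩

theorem viewWith_add (k : P.Rq × (Fin P.parties → P.Rq × P.Rq)) (ct : P.Rq × P.Rq) (m : P.Rq) :
    P.viewWith S k (ct + (m, 0)) = addPlaintext (P.viewWith S k ct) m := by
  exact congrArg (Sum.elim (P.view S k)) (funext (Fin.forall_fin_two.2 ⟨rfl, rfl⟩))

theorem game_zeroView (σ : Strategy S) : σ.game (P.zeroView S) =
    (PMF.uniformOfFintype Bool).bind fun b => P.setup.bind fun k =>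
      (P.enc (P.cpk k) (P.decode fun p => σ.msg (P.view S k) (b, p))).map fun ct =>
        σ.guess (P.viewWith S k ct) == b := by
  simp only [Strategy.game, Params.zeroView, PMF.map_bind, PMF.map_comp, Params.enc_eq_map,
    Function.comp_def, viewWith_add, Strategy.win]
  rfl

theorem fixedGame_eq_bind (m₁ m₂ : P.Rq) (A : Circuit ((ViewIdx S ⊕ Fin 2) × P.Pos) Unit) :
    P.fixedGame S m₁ m₂ A = (PMF.uniformOfFintype (Fin A.coins → Bool)).bind fun r =>
      (fixedStrategy m₁ m₂ A r).game (P.zeroView S) := by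
  have hdecode (b : Bool) : (P.decode fun p => P.encode (if b then m₂ else m₁) p) =
      if b then m₂ else m₁ := P.decode_encode _
  simp only [game_zeroView, Params.fixedGame, monad_bind_eq_bind, monad_pure_eq_pure,
    Circuit.runBit, Circuit.run, fixedStrategy, hdecode, ← PMF.bind_pure_comp,
    PMF.bind_bind, PMF.pure_bind, Function.comp_def,
    PMF.bind_comm (PMF.uniformOfFintype (Fin A.coins → Bool))]

/-- The coins of both stages of a chosen-plaintext adversary. -/
def Params.Adversary.coins (A : P.Adversary S) :
    PMF ((Fin A.choose.coins → Bool) × (Fin A.guess.coins → Bool)) :=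
  (PMF.uniformOfFintype (Fin A.choose.coins → Bool)).bind fun r₁ =>
    (PMF.uniformOfFintype (Fin A.guess.coins → Bool)).map fun r₂ => (r₁, r₂)

theorem cpaGame_eq_bind (A : P.Adversary S) :
    P.cpaGame S A = A.coins.bind fun r => (A.strategy r).game (P.zeroView S) := by
  simp only [game_zeroView, Params.cpaGame, Params.Adversary.coins, monad_bind_eq_bind,
    monad_pure_eq_pure, Circuit.runBit, Circuit.run, Params.Adversary.strategy,
    ← PMF.bind_pure_comp, PMF.bind_bind, PMF.pure_bind, Function.comp_def,
    PMF.bind_comm (PMF.uniformOfFintype (Fin A.guess.coins → Bool)),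
    PMF.bind_comm (PMF.uniformOfFintype (Fin A.choose.coins → Bool))
      (PMF.uniformOfFintype Bool),
    PMF.bind_comm (PMF.uniformOfFintype (Fin A.choose.coins → Bool)) P.setup]
  rfl

end Adversaries

/-! ### Asymptotics -/

namespace PolyBounded

variable {f g : ℕ → ℕ}

theorem mono (hg : PolyBounded g) (h : ∀ κ, f κ ≤ g κ) : PolyBounded f := by
  obtain ⟨p, hp⟩ := hg
  exact ⟨p, fun κ => (h κ).trans (hp κ)⟩

theorem const (c : ℕ) : PolyBounded fun _ => c :=
  ⟨Polynomial.C c, fun κ => by rw [Polynomial.eval_C]⟩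

theorem add (hf : PolyBounded f) (hg : PolyBounded g) : PolyBounded fun κ => f κ + g κ := by
  obtain ⟨p, hp⟩ := hf
  obtain ⟨q, hq⟩ := hg
  exact ⟨p + q, fun κ => by simpa only [Polynomial.eval_add] using add_le_add (hp κ) (hq κ)⟩

theorem mul (hf : PolyBounded f) (hg : PolyBounded g) : PolyBounded fun κ => f κ * g κ := by
  obtain ⟨p, hp⟩ := hf
  obtain ⟨q, hq⟩ := hg
  exact ⟨p * q, fun κ => by simpa only [Polynomial.eval_mul] using Nat.mul_le_mul (hp κ) (hq κ)⟩

theorem simCost {P : ℕ → RingParams} (hdim : PolyBounded fun κ => (P κ).dim)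
    (hmod : PolyBounded fun κ => (P κ).bitLen) {c : ℕ → ℕ} (hc : PolyBounded c) :
    PolyBounded fun κ => MPHE.simCost (P κ) (c κ) := by
  have haffine : PolyBounded fun κ => (P κ).affineCost (5 * ((P κ).dim * (P κ).bitLen)) :=
    (const 2).add (((const 5).mul (hdim.mul hmod)).mul (((const 11).mul hmod).add (const 1)))
  exact (((const 2).mul (hc.mul (((const 2).mul haffine).add (const 1)))).add
    (((hdim.mul hmod).add (const 1)).mul haffine)).add (const 1)

end PolyBounded

theorem RLWEHard.negligible_gap {P : ℕ → RingParams} {secret err : ∀ κ, PMF (P κ).Rq} {m : ℕ}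
    (h : RLWEHard P secret err m) {K : ℕ → ℕ} (hK : PolyBounded K) {g g' : ℕ → PMF Bool}
    (hg : ∀ κ, Reduces (P κ) (rlweSamples (P κ) (secret κ) (err κ) m) (uniformSamples (P κ) m)
      (K κ) (g κ) (g' κ)) :
    Negligible fun κ => gap (g κ) (g' κ) := by
  choose D hD hle using hg
  refine (h D (hK.mono hD)).trans_abs_le fun κ => ?_
  rw [gap, abs_abs, abs_abs]
  exact hle κ

theorem negligible_advantage {P : ℕ → Params} (hdim : PolyBounded fun κ => (P κ).dim)
    (hmod : PolyBounded fun κ => (P κ).bitLen)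
    (hkey : RLWEHard (fun κ => (P κ).toRingParams)
      (fun κ => (P κ).keyDist) (fun κ => (P κ).errDist) 1)
    (henc : RLWEHard (fun κ => (P κ).toRingParams)
      (fun κ => (P κ).encDist) (fun κ => (P κ).errDist) 2)
    {S : ∀ κ, Finset (Fin (P κ).parties)} (hS : ∀ κ, (S κ).card < (P κ).parties)
    {α : ℕ → Type} [∀ κ, Finite (α κ)] (ρ : ∀ κ, PMF (α κ)) {σ : ∀ κ, α κ → Strategy (S κ)}
    {c : ℕ → ℕ} (hc : PolyBounded c) (hσ : ∀ κ r, (σ κ r).CostLE (c κ)) :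
    Negligible fun κ =>
      advantage ((ρ κ).bind fun r => (σ κ r).game ((P κ).zeroView (S κ))) := by
  have hhonest (κ : ℕ) : ∃ h, h ∉ S κ := by
    obtain ⟨h, -, hh⟩ := Finset.exists_mem_notMem_of_card_lt_card
      ((hS κ).trans_eq (Finset.card_fin (P κ).parties).symm)
    exact ⟨h, hh⟩
  choose h hh using hhonest
  have hcost := PolyBounded.simCost hdim hmod hc
  have hreal := hkey.negligible_gap hcost fun κ =>
    Reduces.bind (ρ κ) fun r => (hσ κ r).reduces_key (hh κ)
  have hhybrid := henc.negligible_gap hcost fun κ =>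
    Reduces.bind_left (ρ κ) fun r => (hσ κ r).reduces_enc (h κ)
  refine (hreal.add hhybrid).trans_abs_le fun κ => ?_
  rw [advantage_eq_gap]
  exact abs_le_abs_of_nonneg (abs_nonneg _) (gap_triangle _ _ _)

end MPHE

end

theorem theorem1_general (P : ℕ → MPHE.Params)
    (hdim : MPHE.PolyBounded fun κ => (P κ).dim)
    (hmod : MPHE.PolyBounded fun κ => (P κ).bitLen)
    (hkey : MPHE.RLWEHard (fun κ => (P κ).toRingParams)
      (fun κ => (P κ).keyDist) (fun κ => (P κ).errDist) 1)
    (henc : MPHE.RLWEHard (fun κ => (P κ).toRingParams)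
      (fun κ => (P κ).encDist) (fun κ => (P κ).errDist) 2)
    (S : ∀ κ, Finset (Fin (P κ).parties))
    (hS : ∀ κ, (S κ).card < (P κ).parties) :
    (∀ (m₁ m₂ : ∀ κ, (P κ).Rq)
        (A : ∀ κ, MPHE.Circuit ((MPHE.ViewIdx (S κ) ⊕ Fin 2) × (P κ).Pos) Unit),
      MPHE.PolyBounded (fun κ => (A κ).cost) →
        MPHE.Negligible fun κ => MPHE.advantage ((P κ).fixedGame (S κ) (m₁ κ) (m₂ κ) (A κ))) ∧
    (∀ A : ∀ κ, (P κ).Adversary (S κ),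
      MPHE.PolyBounded (fun κ => (A κ).cost) →
        MPHE.Negligible fun κ => MPHE.advantage ((P κ).cpaGame (S κ) (A κ))) := by
  constructor
  · intro m₁ m₂ A hA
    simp only [MPHE.fixedGame_eq_bind]
    exact MPHE.negligible_advantage hdim hmod hkey henc hS _ ((MPHE.PolyBounded.const 2).add hA)
      fun κ => MPHE.costLE_fixedStrategy (m₁ κ) (m₂ κ) (A κ)
  · intro A hA
    simp only [MPHE.cpaGame_eq_bind]
    exact MPHE.negligible_advantage hdim hmod hkey henc hS _ ((MPHE.PolyBounded.const 4).add hA)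
      fun κ => (A κ).costLE_strategy

theorem theorem1 (P : ℕ → MPHE.Params)
    (hdim : MPHE.PolyBounded fun κ => (P κ).dim)
    (hmod : MPHE.PolyBounded fun κ => (P κ).bitLen)
    (hparties : MPHE.PolyBounded fun κ => (P κ).parties)
    (hkey : MPHE.RLWEHard (fun κ => (P κ).toRingParams)
      (fun κ => (P κ).keyDist) (fun κ => (P κ).errDist) 1)
    (henc : MPHE.RLWEHard (fun κ => (P κ).toRingParams)
      (fun κ => (P κ).encDist) (fun κ => (P κ).errDist) 2)
    (S : ∀ κ, Finset (Fin (P κ).parties))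
    (hS : ∀ κ, (S κ).card < (P κ).parties) :
    (∀ (m₁ m₂ : ∀ κ, (P κ).Rq)
        (A : ∀ κ, MPHE.Circuit ((MPHE.ViewIdx (S κ) ⊕ Fin 2) × (P κ).Pos) Unit),
      MPHE.PolyBounded (fun κ => (A κ).cost) →
        MPHE.Negligible fun κ => MPHE.advantage ((P κ).fixedGame (S κ) (m₁ κ) (m₂ κ) (A κ))) ∧
    (∀ A : ∀ κ, (P κ).Adversary (S κ),
      MPHE.PolyBounded (fun κ => (A κ).cost) →
        MPHE.Negligible fun κ => MPHE.advantage ((P κ).cpaGame (S κ) (A κ))) :=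
  theorem1_general P hdim hmod hkey henc S hS
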